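/- Let $k$ be a commutative associative unital ring; algebras over $k$ are associative but need not be unital. Say that a set $E$ of pairwise orthogonal idempotents of a $k$-algebra $R$ is a set of orthogonal local units of $R$ if $R=\bigoplus_{e\in E}Re=\bigoplus_{e\in E}eR$. For a set $X$ let $\mathrm{FMat}_X(R)$ be the $k$-algebra of all $X\times X$-matrices over $R$ with only finitely many non-zero entries. Let $R$ and $R'$ be $k$-algebras with sets of orthogonal local units $E$ and $F$, respectively, and let $X$ be an infinite set with $|X|\ge |E|$ and $|X|\ge |F|$. Suppose that $R$ and $R'$ are Morita equivalent through a Morita context $(R,R',M,M',\tau,\tau')$ with unital modules and surjective maps; that is, $M$ is an $R$-$R'$-bimodule and $M'$ is an $R'$-$R$-bimodule (with $k$-bilinear actions) such that $RM=M=MR'$ and $R'M'=M'=M'R$, and $\tau:M\otimes_{R'}M'\to R$ and $\tau':M'\otimes_R M\to R'$ are surjective $k$-linear maps of $R$-bimodules and of $R'$-bimodules, respectively, with $$\tau(m_1\otimes m')\,m_2=m_1\,\tau'(m'\otimes m_2),\qquad \tau'(m_1'\otimes m)\,m_2'=m_1'\,\tau(m\otimes m_2')$$ for all $m,m_1,m_2\in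 M$ and $m',m_1',m_2'\in M'$. Then $\mathrm{FMat}_X(R)$ and $\mathrm{FMat}_X(R')$ are isomorphic as $k$-algebras (in particular as rings). -/

import Mathlib

open scoped TensorProduct

namespace StableMorita

/-! Algebras over a commutative unital ring `k` are associative and not necessarily unital:
`[NonUnitalRing R] [Module k R] [IsScalarTower k R R] [SMulCommClass k R R]`.
Mathlib's `Module` needs a unital ring of scalars, hence the bimodules defined here. -/

/-- The structure of an `A`-`B`-bimodule on a `k`-module `M`, for (not necessarily unital)
`k`-algebras `A` and `B`: `left a m` is `a m` and `right b m` is `m b`. -/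
structure Bimod (k A B M : Type*) [CommRing k]
    [NonUnitalRing A] [Module k A] [NonUnitalRing B] [Module k B]
    [AddCommGroup M] [Module k M] where
  left : A →ₗ[k] M →ₗ[k] M
  right : B →ₗ[k] M →ₗ[k] M
  left_mul : ∀ a₁ a₂ m, left (a₁ * a₂) m = left a₁ (left a₂ m)
  right_mul : ∀ b₁ b₂ m, right (b₁ * b₂) m = right b₂ (right b₁ m)
  left_right : ∀ a b m, right b (left a m) = left a (right b m)

/-- The bimodule is unital on both sides: `A M = M` and `M B = M`, where `A M` and `M B` are the
sets of finite sums of products. -/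
structure Bimod.IsUnital {k A B M : Type*} [CommRing k]
    [NonUnitalRing A] [Module k A] [NonUnitalRing B] [Module k B]
    [AddCommGroup M] [Module k M] (S : Bimod k A B M) : Prop where
  left_unital : AddSubgroup.closure {x : M | ∃ a m, S.left a m = x} = ⊤
  right_unital : AddSubgroup.closure {x : M | ∃ b m, S.right b m = x} = ⊤

section Tensor

variable {k A B C M N : Type*} [CommRing k]
  [NonUnitalRing A] [Module k A] [NonUnitalRing B] [Module k B] [NonUnitalRing C] [Module k C]
  [AddCommGroup M] [Module k M] [AddCommGroup N] [Module k N]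

/-- The relations `m b ⊗ n = m ⊗ b n` that cut `M ⊗_B N` out of `M ⊗_k N`. -/
def balancing (S : Bimod k A B M) (T : Bimod k B C N) : Submodule k (M ⊗[k] N) :=
  Submodule.span k {t | ∃ m b n, t = S.right b m ⊗ₜ[k] n - m ⊗ₜ[k] T.left b n}

/-- The tensor product `M ⊗_B N` of an `A`-`B`-bimodule `M` and a `B`-`C`-bimodule `N`. -/
abbrev TensorOver (S : Bimod k A B M) (T : Bimod k B C N) : Type _ :=
  (M ⊗[k] N) ⧸ balancing S T

/-- The pure tensor `m ⊗ n` in `M ⊗_B N`. -/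
def tmulOver (S : Bimod k A B M) (T : Bimod k B C N) (m : M) (n : N) : TensorOver S T :=
  Submodule.Quotient.mk (m ⊗ₜ[k] n)

end Tensor

/-- A Morita context `(R, R', M, M', τ, τ')` of `k`-algebras. -/
structure MoritaContext (k R R' M M' : Type*) [CommRing k]
    [NonUnitalRing R] [Module k R] [NonUnitalRing R'] [Module k R']
    [AddCommGroup M] [Module k M] [AddCommGroup M'] [Module k M'] where
  bimod : Bimod k R R' M
  bimod' : Bimod k R' R M'
  τ : TensorOver bimod bimod' →ₗ[k] R
  τ' : TensorOver bimod' bimod →ₗ[k] R'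
  τ_left : ∀ r m m', τ (tmulOver bimod bimod' (bimod.left r m) m') =
    r * τ (tmulOver bimod bimod' m m')
  τ_right : ∀ r m m', τ (tmulOver bimod bimod' m (bimod'.right r m')) =
    τ (tmulOver bimod bimod' m m') * r
  τ'_left : ∀ r' m' m, τ' (tmulOver bimod' bimod (bimod'.left r' m') m) =
    r' * τ' (tmulOver bimod' bimod m' m)
  τ'_right : ∀ r' m' m, τ' (tmulOver bimod' bimod m' (bimod.right r' m)) =
    τ' (tmulOver bimod' bimod m' m) * r'
  /-- `τ(m₁ ⊗ m') m₂ = m₁ τ'(m' ⊗ m₂)` -/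
  assoc : ∀ m₁ m' m₂, bimod.left (τ (tmulOver bimod bimod' m₁ m')) m₂ =
    bimod.right (τ' (tmulOver bimod' bimod m' m₂)) m₁
  /-- `τ'(m'₁ ⊗ m) m'₂ = m'₁ τ(m ⊗ m'₂)` -/
  assoc' : ∀ m'₁ m m'₂, bimod'.left (τ' (tmulOver bimod' bimod m'₁ m)) m'₂ =
    bimod'.right (τ (tmulOver bimod bimod' m m'₂)) m'₁

open scoped Classical in
/-- `E` is a set of orthogonal local units of `R`: pairwise orthogonal idempotents with
`R = ⨁_{e ∈ E} R e = ⨁_{e ∈ E} e R`. -/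
structure IsOrthogonalLocalUnits (k : Type*) {R : Type*} [CommRing k]
    [NonUnitalRing R] [Module k R] [IsScalarTower k R R] [SMulCommClass k R R]
    (E : Set R) : Prop where
  idem : ∀ e ∈ E, e * e = e
  orthogonal : ∀ e ∈ E, ∀ f ∈ E, e ≠ f → e * f = 0
  right_internal : DirectSum.IsInternal fun e : E => LinearMap.range (LinearMap.mulRight k (e : R))
  left_internal : DirectSum.IsInternal fun e : E => LinearMap.range (LinearMap.mulLeft k (e : R))

/-- `FMat X R`: the `X × X`-matrices over `R` with only finitely many non-zero entries. -/
def FMat (X R : Type*) [Zero R] : Type _ := (X × X) →₀ R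

namespace FMat

variable {X R : Type*}

/-- The `(i, j)`-entry of a matrix. -/
def entry [Zero R] (A : FMat X R) (i j : X) : R := (show (X × X) →₀ R from A) (i, j)

theorem ext [Zero R] {A B : FMat X R} (h : ∀ i j, A.entry i j = B.entry i j) : A = B :=
  Finsupp.ext fun p => h p.1 p.2

/-- Finitely many indices which contain the row and the column of every non-zero entry. -/
theorem exists_finset [Zero R] (A : FMat X R) :
    ∃ s : Finset X, ∀ i j, A.entry i j ≠ 0 → i ∈ s ∧ j ∈ s := by
  classical
  refine ⟨Finset.image Prod.fst (Finsupp.support A) ∪ Finset.image Prod.snd (Finsupp.support A),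
    fun i j h => ?_⟩
  have h2 : (i, j) ∈ Finsupp.support (show (X × X) →₀ R from A) := Finsupp.mem_support_iff.2 h
  exact ⟨Finset.mem_union_left _ (Finset.mem_image.2 ⟨_, h2, rfl⟩),
    Finset.mem_union_right _ (Finset.mem_image.2 ⟨_, h2, rfl⟩)⟩

/-- A matrix is determined by a function with finite support. -/
noncomputable def ofFun [Zero R] (f : X → X → R) (hf : ({p | f p.1 p.2 ≠ 0} : Set (X × X)).Finite) :
    FMat X R :=
  (Finsupp.ofSupportFinite (fun p : X × X => f p.1 p.2) hf : (X × X) →₀ R)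

@[simp] theorem entry_ofFun [Zero R] (f : X → X → R)
    (hf : ({p | f p.1 p.2 ≠ 0} : Set (X × X)).Finite) (i j : X) : (ofFun f hf).entry i j = f i j :=
  rfl

noncomputable instance [AddCommGroup R] : AddCommGroup (FMat X R) :=
  inferInstanceAs (AddCommGroup ((X × X) →₀ R))

noncomputable instance {k : Type*} [CommRing k] [AddCommGroup R] [Module k R] :
    Module k (FMat X R) :=
  inferInstanceAs (Module k ((X × X) →₀ R))

@[simp] theorem entry_zero [AddCommGroup R] (i j : X) : (0 : FMat X R).entry i j = 0 := rfl

@[simp] theorem entry_add [AddCommGroup R] (A B : FMat X R) (i j : X) :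
    (A + B).entry i j = A.entry i j + B.entry i j := rfl

@[simp] theorem entry_smul {k : Type*} [CommRing k] [AddCommGroup R] [Module k R] (c : k)
    (A : FMat X R) (i j : X) : (c • A).entry i j = c • A.entry i j := rfl

variable [NonUnitalRing R]

theorem finsum_entry_eq {A B : FMat X R} {s : Finset X}
    (hs : ∀ i j, A.entry i j ≠ 0 → i ∈ s ∧ j ∈ s) (i j : X) :
    ∑ᶠ l, A.entry i l * B.entry l j = ∑ l ∈ s, A.entry i l * B.entry l j := by
  refine finsum_eq_sum_of_support_subset _ fun l hl => ?_
  exact (hs i l (left_ne_zero_of_mul hl)).2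

theorem finite_mul (A B : FMat X R) :
    ({p | ∑ᶠ l, A.entry p.1 l * B.entry l p.2 ≠ 0} : Set (X × X)).Finite := by
  obtain ⟨s, hs⟩ := A.exists_finset
  obtain ⟨t, ht⟩ := B.exists_finset
  refine (s ×ˢ t).finite_toSet.subset fun p hp => ?_
  obtain ⟨l, hl⟩ : ∃ l, A.entry p.1 l * B.entry l p.2 ≠ 0 := by
    by_contra! h
    exact hp (by simp [h])
  exact Finset.mem_coe.2 (Finset.mem_product.2
    ⟨(hs _ _ (left_ne_zero_of_mul hl)).1, (ht _ _ (right_ne_zero_of_mul hl)).2⟩)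

/-- Matrix multiplication, `(A B)_{ij} = ∑_l A_{il} B_{lj}` (a finite sum). -/
noncomputable instance : Mul (FMat X R) where
  mul A B := ofFun (fun i j => ∑ᶠ l, A.entry i l * B.entry l j) (finite_mul A B)

theorem entry_mul (A B : FMat X R) (i j : X) :
    (A * B).entry i j = ∑ᶠ l, A.entry i l * B.entry l j := rfl

theorem entry_mul_eq_sum {A : FMat X R} (B : FMat X R) {s : Finset X}
    (hs : ∀ i j, A.entry i j ≠ 0 → i ∈ s ∧ j ∈ s) (i j : X) :
    (A * B).entry i j = ∑ l ∈ s, A.entry i l * B.entry l j := finsum_entry_eq hs i j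

noncomputable instance : NonUnitalRing (FMat X R) where
  left_distrib A B C := by
    obtain ⟨s, hs⟩ := A.exists_finset
    refine ext fun i j => ?_
    simp [entry_mul_eq_sum _ hs, mul_add, Finset.sum_add_distrib]
  right_distrib A B C := by
    classical
    obtain ⟨s, hs⟩ := A.exists_finset
    obtain ⟨t, ht⟩ := B.exists_finset
    have hs1 : ∀ i j, A.entry i j ≠ 0 → i ∈ s ∪ t ∧ j ∈ s ∪ t := fun i j h => by
      have := hs i j h; simp [this]
    have ht1 : ∀ i j, B.entry i j ≠ 0 → i ∈ s ∪ t ∧ j ∈ s ∪ t := fun i j h => by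
      have := ht i j h; simp [this]
    have hst : ∀ i j, (A + B).entry i j ≠ 0 → i ∈ s ∪ t ∧ j ∈ s ∪ t := fun i j h => by
      by_cases hA : A.entry i j = 0
      · exact ht1 i j fun hB => h (by simp [hA, hB])
      · exact hs1 i j hA
    refine ext fun i j => ?_
    simp [entry_mul_eq_sum _ hs1, entry_mul_eq_sum _ ht1, entry_mul_eq_sum _ hst, add_mul,
      Finset.sum_add_distrib]
  zero_mul A := ext fun i j => by simp [entry_mul]
  mul_zero A := ext fun i j => by simp [entry_mul]
  mul_assoc A B C := by
    obtain ⟨s, hs⟩ := A.exists_finset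
    obtain ⟨t, ht⟩ := B.exists_finset
    have h : ∀ i j, (A * B).entry i j ≠ 0 → j ∈ t := fun i j hij => by
      obtain ⟨l, hl⟩ : ∃ l, A.entry i l * B.entry l j ≠ 0 := by
        by_contra! h0
        exact hij (by simp [entry_mul, h0])
      exact (ht _ _ (right_ne_zero_of_mul hl)).2
    refine ext fun i j => ?_
    have h1 : (A * B * C).entry i j = ∑ l ∈ t, (A * B).entry i l * C.entry l j :=
      finsum_eq_sum_of_support_subset _ fun l hl => h i l (left_ne_zero_of_mul hl)
    rw [h1, entry_mul_eq_sum _ hs]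
    simp only [entry_mul_eq_sum _ hs, entry_mul_eq_sum _ ht, Finset.sum_mul, Finset.mul_sum,
      mul_assoc]
    exact Finset.sum_comm

end FMat

end StableMorita

/-!
Pair `M` with `M'` through `τ`. The matrix algebra `FMat X R'` acts on the row vectors `M^(X)` from
the right, faithfully, and as the algebra of finite rank operators `x ↦ ∑ ⟨x, q⟩ p` of the pairing
of `M^(X)` with `M'^(X)`; this uses that `τ'` is onto. In the same way `FMat X R` is the algebra of
finite rank operators of the pairing of `R^(X)` with itself by multiplication. An isomorphism of
pairings conjugates finite rank operators into finite rank operators, so it is enough to find one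
between these two.

Writing every local unit as a sum of values of `τ`, resp. `τ'`, makes each of the pairings
`R × R → R` and `M × M' → R` a direct summand of a sum of `|X|` copies of the other. As `X` is
infinite, Pełczyński's decomposition argument shows that the sums of `|X|` copies are isomorphic.
-/

namespace StableMorita

section Cardinality

variable (X : Type*) [Infinite X]

theorem nonempty_prod_self_equiv : Nonempty (X × X ≃ X) :=
  Cardinal.eq.1 (by simp [Cardinal.mul_eq_self (Cardinal.aleph0_le_mk X)])

theorem nonempty_sum_self_equiv : Nonempty (X ⊕ X ≃ X) :=
  Cardinal.eq.1 (by simp [Cardinal.add_eq_self (Cardinal.aleph0_le_mk X)])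

variable {X}

theorem nonempty_sigma_embedding {ι : Type*} (j : ι ↪ X) (κ : ι → Type*) [∀ i, Countable (κ i)] :
    Nonempty ((Σ i, κ i) ↪ X) := by
  obtain ⟨f⟩ := nonempty_prod_self_equiv X
  choose c hc using fun i => exists_injective_nat (κ i)
  exact ⟨((j.sigmaMap fun i => (⟨c i, hc i⟩ : κ i ↪ ℕ).trans (Infinite.natEmbedding X)).trans
    (Equiv.sigmaEquivProd X X).toEmbedding).trans f.toEmbedding⟩

end Cardinality

section Linear

variable {k ι P P' P'' : Type*} [CommRing k] [AddCommGroup P] [Module k P]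
  [AddCommGroup P'] [Module k P'] [AddCommGroup P''] [Module k P'']

/-- Finitely supported functions into a product are pairs of finitely supported functions. -/
noncomputable def finsuppProdLEquiv : (ι →₀ P × P') ≃ₗ[k] (ι →₀ P) × (ι →₀ P') :=
  .ofLinearMap
    ((Finsupp.mapRange.linearMap (.fst k P P')).prod (Finsupp.mapRange.linearMap (.snd k P P')))
    ((Finsupp.mapRange.linearMap (.inl k P P')).coprod (Finsupp.mapRange.linearMap (.inr k P P')))
    (by ext <;> simp) (by ext <;> simp)

/-- A locally finite family of linear maps, as a map into the finitely supported functions. -/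
noncomputable def finsuppPi (f : ι → P →ₗ[k] P')
    (hf : ∀ x, (Function.support fun i => f i x).Finite) : P →ₗ[k] ι →₀ P' where
  toFun x := .ofSupportFinite _ (hf x)
  map_add' x y := by ext; simp [Finsupp.ofSupportFinite_coe]
  map_smul' c x := by ext; simp [Finsupp.ofSupportFinite_coe]

@[simp] theorem finsuppPi_apply (f : ι → P →ₗ[k] P')
    (hf : ∀ x, (Function.support fun i => f i x).Finite) (x : P) (i : ι) :
    finsuppPi f hf x i = f i x := rfl

theorem lsum_finsuppPi (g : ι → P' →ₗ[k] P'') (f : ι → P →ₗ[k] P')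
    (hf : ∀ x, (Function.support fun i => f i x).Finite) {x : P} {s : Finset ι}
    (hs : ∀ i ∉ s, f i x = 0) :
    Finsupp.lsum k g (finsuppPi f hf x) = ∑ i ∈ s, g i (f i x) :=
  Finsupp.sum_of_support_subset _
    (fun i hi => by_contra fun his => Finsupp.mem_support_iff.1 hi (hs i his)) _ (by simp)

/-- The splitting of a linear map `p` with section `i`. -/
def prodKerEquiv (i : P →ₗ[k] P') (p : P' →ₗ[k] P) (h : ∀ x, p (i x) = x) :
    (P × LinearMap.ker p) ≃ₗ[k] P' where
  __ := i.coprod (LinearMap.ker p).subtype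
  invFun y := (p y, ⟨y - i (p y), by simp [h]⟩)
  left_inv x := by ext <;> simp [h]
  right_inv y := by simp

@[simp] theorem prodKerEquiv_apply (i : P →ₗ[k] P') (p : P' →ₗ[k] P) (h : ∀ x, p (i x) = x)
    (x : P × LinearMap.ker p) : prodKerEquiv i p h x = i x.1 + x.2 := rfl

end Linear

/-- An `R`-valued pairing of `P` and `Q` together with an action of `R` on `P`; the model is a left
`R`-module `P` paired with a right `R`-module `Q`. No law relates the action to the pairing: the
decomposition argument and the operators `x ↦ ⟨x, q⟩ p` need none. -/
structure Pairing (k R P Q : Type*) [CommRing k] [AddCommGroup R] [Module k R]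
    [AddCommGroup P] [Module k P] [AddCommGroup Q] [Module k Q] where
  act : R →ₗ[k] P →ₗ[k] P
  pair : P →ₗ[k] Q →ₗ[k] R

namespace Pairing

variable {k R : Type*} [CommRing k] [AddCommGroup R] [Module k R]
  {P Q P' Q' P'' Q'' P₁ Q₁ P₁' Q₁' : Type*}
  [AddCommGroup P] [Module k P] [AddCommGroup Q] [Module k Q]
  [AddCommGroup P'] [Module k P'] [AddCommGroup Q'] [Module k Q']
  [AddCommGroup P''] [Module k P''] [AddCommGroup Q''] [Module k Q'']
  [AddCommGroup P₁] [Module k P₁] [AddCommGroup Q₁] [Module k Q₁]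
  [AddCommGroup P₁'] [Module k P₁'] [AddCommGroup Q₁'] [Module k Q₁']
  {ι κ : Type*}

/-- The direct sum of two pairings. -/
def prod (S : Pairing k R P Q) (T : Pairing k R P' Q') : Pairing k R (P × P') (Q × Q') where
  act := LinearMap.mk₂ k (fun r x => (S.act r x.1, T.act r x.2))
    (fun _ _ _ => by ext <;> simp) (fun _ _ _ => by ext <;> simp) (fun _ _ _ => by ext <;> simp)
    (fun _ _ _ => by ext <;> simp)
  pair := S.pair.compl₁₂ (.fst k P P') (.fst k Q Q') + T.pair.compl₁₂ (.snd k P P') (.snd k Q Q')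

@[simp] theorem prod_act (S : Pairing k R P Q) (T : Pairing k R P' Q') (r : R) (x : P × P') :
    (S.prod T).act r x = (S.act r x.1, T.act r x.2) := rfl

@[simp] theorem prod_pair (S : Pairing k R P Q) (T : Pairing k R P' Q') (x : P × P')
    (y : Q × Q') : (S.prod T).pair x y = S.pair x.1 y.1 + T.pair x.2 y.2 := rfl

/-- The direct sum of copies of a pairing, indexed by `ι`. -/
noncomputable def finsupp (S : Pairing k R P Q) (ι : Type*) :
    Pairing k R (ι →₀ P) (ι →₀ Q) where
  act := LinearMap.mk₂ k (fun r x => Finsupp.mapRange.linearMap (S.act r) x)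
    (fun _ _ _ => by ext; simp) (fun _ _ _ => by ext; simp) (fun _ _ _ => by ext; simp)
    (fun _ _ _ => by ext; simp)
  pair := Finsupp.lsum k fun i => S.pair.compl₂ (Finsupp.lapply i)

@[simp] theorem finsupp_act_apply (S : Pairing k R P Q) (r : R) (x : ι →₀ P) (i : ι) :
    (S.finsupp ι).act r x i = S.act r (x i) := by
  simp [finsupp]

@[simp] theorem finsupp_act_single (S : Pairing k R P Q) (r : R) (i : ι) (p : P) :
    (S.finsupp ι).act r (Finsupp.single i p) = Finsupp.single i (S.act r p) := by
  simp [finsupp]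

@[simp] theorem finsupp_pair_single (S : Pairing k R P Q) (i : ι) (p : P) (y : ι →₀ Q) :
    (S.finsupp ι).pair (Finsupp.single i p) y = S.pair p (y i) := by
  simp [finsupp]

theorem finsupp_pair_single_right (S : Pairing k R P Q) (x : ι →₀ P) (i : ι) (q : Q) :
    (S.finsupp ι).pair x (Finsupp.single i q) = S.pair (x i) q := by
  classical
  suffices (S.finsupp ι).pair.flip (Finsupp.single i q) = S.pair.flip q ∘ₗ Finsupp.lapply i from
    LinearMap.congr_fun this x
  ext j p
  by_cases h : i = j
  · subst h; simp
  · simp [h, Ne.symm h]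

theorem bilin_ext_single {f g : (ι →₀ P) →ₗ[k] Q →ₗ[k] R}
    (h : ∀ i p y, f (Finsupp.single i p) y = g (Finsupp.single i p) y) : f = g :=
  Finsupp.lhom_ext' fun i => LinearMap.ext₂ fun p y => h i p y

/-- An isomorphism of pairings. Both components are covariant, unlike those of a morphism. -/
structure Equiv (S : Pairing k R P Q) (T : Pairing k R P' Q') where
  map : P ≃ₗ[k] P'
  dual : Q ≃ₗ[k] Q'
  map_act : ∀ r, (map : P →ₗ[k] P') ∘ₗ S.act r = T.act r ∘ₗ map
  map_pair : T.pair.compl₁₂ (map : P →ₗ[k] P') (dual : Q →ₗ[k] Q') = S.pair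

namespace Equiv

variable {S : Pairing k R P Q} {T : Pairing k R P' Q'} {U : Pairing k R P'' Q''}
  {S₁ : Pairing k R P₁ Q₁} {T₁ : Pairing k R P₁' Q₁'}

@[simp] theorem map_act_apply (e : Equiv S T) (r : R) (x : P) :
    e.map (S.act r x) = T.act r (e.map x) := LinearMap.congr_fun (e.map_act r) x

@[simp] theorem map_pair_apply (e : Equiv S T) (x : P) (y : Q) :
    T.pair (e.map x) (e.dual y) = S.pair x y := LinearMap.congr_fun₂ e.map_pair x y

/-- The identity isomorphism. -/
def refl (S : Pairing k R P Q) : Equiv S S := ⟨.refl k P, .refl k Q, fun _ => rfl, rfl⟩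

/-- The inverse isomorphism. -/
def symm (e : Equiv S T) : Equiv T S where
  map := e.map.symm
  dual := e.dual.symm
  map_act r := by ext x; simp [LinearEquiv.symm_apply_eq]
  map_pair := by ext x y; simp [← e.map_pair]

/-- The composite of two isomorphisms. -/
def trans (e : Equiv S T) (f : Equiv T U) : Equiv S U where
  map := e.map.trans f.map
  dual := e.dual.trans f.dual
  map_act r := by ext; simp
  map_pair := by ext; simp

/-- Direct sums of isomorphic pairings are isomorphic. -/
def prodCongr (e : Equiv S T) (f : Equiv S₁ T₁) :
    Equiv (S.prod S₁) (T.prod T₁) where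
  map := e.map.prodCongr f.map
  dual := e.dual.prodCongr f.dual
  map_act r := by ext <;> simp
  map_pair := by ext <;> simp

/-- The direct sum of pairings is commutative. -/
def prodComm (S : Pairing k R P Q) (T : Pairing k R P' Q') :
    Equiv (S.prod T) (T.prod S) where
  map := .prodComm k P P'
  dual := .prodComm k Q Q'
  map_act r := rfl
  map_pair := by ext <;> simp

/-- The direct sum of pairings is associative. -/
def prodAssoc (S : Pairing k R P Q) (T : Pairing k R P' Q') (U : Pairing k R P'' Q'') :
    Equiv ((S.prod T).prod U) (S.prod (T.prod U)) where
  map := .prodAssoc k P P' P''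
  dual := .prodAssoc k Q Q' Q''
  map_act r := rfl
  map_pair := by ext <;> simp

/-- Sums of copies of isomorphic pairings are isomorphic. -/
noncomputable def finsuppCongr (e : Equiv S T) (ι : Type*) :
    Equiv (S.finsupp ι) (T.finsupp ι) where
  map := Finsupp.mapRange.linearEquiv e.map
  dual := Finsupp.mapRange.linearEquiv e.dual
  map_act r := by ext; simp
  map_pair := bilin_ext_single fun i p y => by simp

/-- Sums of copies of a pairing can be reindexed. -/
noncomputable def finsuppDomCongr (S : Pairing k R P Q) (e : ι ≃ κ) :
    Equiv (S.finsupp ι) (S.finsupp κ) where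
  map := Finsupp.domLCongr e
  dual := Finsupp.domLCongr e
  map_act r := by ext; simp
  map_pair := bilin_ext_single fun i p y => by simp

/-- A sum indexed by a product is an iterated sum. -/
noncomputable def finsuppCurry (S : Pairing k R P Q) (ι κ : Type*) :
    Equiv (S.finsupp (ι × κ)) ((S.finsupp κ).finsupp ι) where
  map := Finsupp.curryLinearEquiv k
  dual := Finsupp.curryLinearEquiv k
  map_act r := by ext; simp
  map_pair := bilin_ext_single fun i p y => by simp

/-- A sum indexed by a disjoint union is a direct sum. -/
noncomputable def finsuppSum (S : Pairing k R P Q) (ι κ : Type*) :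
    Equiv (S.finsupp (ι ⊕ κ)) ((S.finsupp ι).prod (S.finsupp κ)) where
  map := Finsupp.sumFinsuppLEquivProdFinsupp k
  dual := Finsupp.sumFinsuppLEquivProdFinsupp k
  map_act r := LinearMap.ext fun x => by ext <;> simp
  map_pair := bilin_ext_single fun i p y => by
    classical
    rcases i with i | i
    · have hi : Finsupp.sumFinsuppLEquivProdFinsupp k (Finsupp.single (Sum.inl i : ι ⊕ κ) p) =
          (Finsupp.single i p, 0) := by ext <;> simp [Finsupp.single_apply]
      simp [hi]
    · have hi : Finsupp.sumFinsuppLEquivProdFinsupp k (Finsupp.single (Sum.inr i : ι ⊕ κ) p) =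
          (0, Finsupp.single i p) := by ext <;> simp [Finsupp.single_apply]
      simp [hi]

/-- Summing copies commutes with direct sums. -/
noncomputable def finsuppProd (S : Pairing k R P Q) (T : Pairing k R P' Q') (ι : Type*) :
    Equiv ((S.prod T).finsupp ι) ((S.finsupp ι).prod (T.finsupp ι)) where
  map := finsuppProdLEquiv
  dual := finsuppProdLEquiv
  map_act r := by ext <;> simp [finsuppProdLEquiv]
  map_pair := bilin_ext_single fun i p y => by simp [finsuppProdLEquiv]

end Equiv

/-- A morphism of pairings: a linear map with an adjoint, compatible with the actions. -/
structure Hom (S : Pairing k R P Q) (T : Pairing k R P' Q') where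
  map : P →ₗ[k] P'
  adjoint : Q' →ₗ[k] Q
  map_act : ∀ r, map ∘ₗ S.act r = T.act r ∘ₗ map
  pair_map : T.pair ∘ₗ map = S.pair.compl₂ adjoint

namespace Hom

variable {S : Pairing k R P Q} {T : Pairing k R P' Q'} {U : Pairing k R P'' Q''}

@[simp] theorem map_act_apply (f : Hom S T) (r : R) (x : P) :
    f.map (S.act r x) = T.act r (f.map x) := LinearMap.congr_fun (f.map_act r) x

@[simp] theorem pair_map_apply (f : Hom S T) (x : P) (y : Q') :
    T.pair (f.map x) y = S.pair x (f.adjoint y) := LinearMap.congr_fun₂ f.pair_map x y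

/-- The composite of two morphisms. -/
def comp (g : Hom T U) (f : Hom S T) : Hom S U where
  map := g.map ∘ₗ f.map
  adjoint := f.adjoint ∘ₗ g.adjoint
  map_act r := by ext; simp
  pair_map := by ext; simp

/-- The morphism into a sum of copies with prescribed components. -/
noncomputable def toFinsupp (a : ι → Hom S T)
    (ha : ∀ x, (Function.support fun i => (a i).map x).Finite) : Hom S (T.finsupp ι) where
  map := finsuppPi (fun i => (a i).map) ha
  adjoint := Finsupp.lsum k fun i => (a i).adjoint
  map_act r := by ext; simp
  pair_map := LinearMap.ext fun x => Finsupp.lhom_ext fun i q => by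
    simp [finsupp_pair_single_right]

/-- The morphism out of a sum of copies with prescribed components. -/
noncomputable def ofFinsupp (b : ι → Hom T S)
    (hb : ∀ y, (Function.support fun i => (b i).adjoint y).Finite) : Hom (T.finsupp ι) S where
  map := Finsupp.lsum k fun i => (b i).map
  adjoint := finsuppPi (fun i => (b i).adjoint) hb
  map_act r := by ext; simp
  pair_map := bilin_ext_single fun i p y => by simp

end Hom

/-- `S` is a retract of `T`: both on the vectors of `S` and, through the adjoints, on its
covectors. -/
structure Retract (S : Pairing k R P Q) (T : Pairing k R P' Q') where
  incl : Hom S T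
  proj : Hom T S
  proj_incl : ∀ x, proj.map (incl.map x) = x
  adjoint_incl_proj : ∀ y, incl.adjoint (proj.adjoint y) = y

namespace Retract

variable {S : Pairing k R P Q} {T : Pairing k R P' Q'} {U : Pairing k R P'' Q''}

attribute [simp] proj_incl adjoint_incl_proj

/-- Retracts compose. -/
def trans (e : Retract S T) (f : Retract T U) : Retract S U where
  incl := f.incl.comp e.incl
  proj := e.proj.comp f.proj
  proj_incl x := by simp [Hom.comp]
  adjoint_incl_proj y := by simp [Hom.comp]

/-- The complement of a retract: the kernel of the projection paired with the kernel of the adjoint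
of the inclusion. -/
def compl (e : Retract S T) :
    Pairing k R (LinearMap.ker e.proj.map) (LinearMap.ker e.incl.adjoint) where
  act := LinearMap.mk₂ k
    (fun r z => ⟨T.act r z, by
      rw [LinearMap.mem_ker, Hom.map_act_apply, LinearMap.mem_ker.1 z.2, map_zero]⟩)
    (fun _ _ _ => by ext; simp) (fun _ _ _ => by ext; simp) (fun _ _ _ => by ext; simp)
    (fun _ _ _ => by ext; simp)
  pair := T.pair.compl₁₂ (LinearMap.ker e.proj.map).subtype (LinearMap.ker e.incl.adjoint).subtype

@[simp] theorem coe_compl_act (e : Retract S T) (r : R) (z : LinearMap.ker e.proj.map) :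
    (e.compl.act r z : P') = T.act r z := rfl

@[simp] theorem compl_pair (e : Retract S T) (z : LinearMap.ker e.proj.map)
    (w : LinearMap.ker e.incl.adjoint) : e.compl.pair z w = T.pair z w := rfl

/-- A retract is a direct summand. -/
def prodCompl (e : Retract S T) : Equiv (S.prod e.compl) T where
  map := prodKerEquiv e.incl.map e.proj.map e.proj_incl
  dual := prodKerEquiv e.proj.adjoint e.incl.adjoint e.adjoint_incl_proj
  map_act r := by ext <;> simp
  map_pair := LinearMap.ext₂ fun x y => by simp [← e.proj.pair_map_apply]

/-- A sum of fewer copies is a retract of a sum of more copies. -/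
noncomputable def finsuppOfEmbedding (S : Pairing k R P Q) (j : ι ↪ κ) :
    Retract (S.finsupp ι) (S.finsupp κ) where
  incl :=
    { map := Finsupp.lmapDomain P k j
      adjoint := Finsupp.lcomapDomain j j.injective
      map_act r := by ext; simp
      pair_map := bilin_ext_single fun i p y => by simp }
  proj :=
    { map := Finsupp.lcomapDomain j j.injective
      adjoint := Finsupp.lmapDomain Q k j
      map_act r := LinearMap.ext fun x => by ext; simp
      pair_map := LinearMap.ext fun x => Finsupp.lhom_ext fun i q => by
        simp [finsupp_pair_single_right] }
  proj_incl := Finsupp.leftInverse_lcomapDomain_mapDomain j j.injective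
  adjoint_incl_proj := Finsupp.leftInverse_lcomapDomain_mapDomain j j.injective

/-- A retract of a sum of copies, given by locally finite families of morphisms whose composites add
up to the identity. -/
noncomputable def ofFamily (a : ι → Hom S T) (b : ι → Hom T S)
    (h : ∀ x, ∃ s : Finset ι, (∀ i ∉ s, (a i).map x = 0) ∧ ∑ i ∈ s, (b i).map ((a i).map x) = x)
    (h' : ∀ y, ∃ s : Finset ι,
      (∀ i ∉ s, (b i).adjoint y = 0) ∧ ∑ i ∈ s, (a i).adjoint ((b i).adjoint y) = y) :
    Retract S (T.finsupp ι) where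
  incl := .toFinsupp a fun x => (h x).elim fun s hs =>
    s.finite_toSet.subset fun i hi => by_contra fun his => hi (hs.1 i his)
  proj := .ofFinsupp b fun y => (h' y).elim fun s hs =>
    s.finite_toSet.subset fun i hi => by_contra fun his => hi (hs.1 i his)
  proj_incl x := by
    obtain ⟨s, hs, hx⟩ := h x
    exact (lsum_finsuppPi _ _ _ hs).trans hx
  adjoint_incl_proj y := by
    obtain ⟨s, hs, hy⟩ := h' y
    exact (lsum_finsuppPi _ _ _ hs).trans hy

end Retract

section Decomposition

variable {S : Pairing k R P Q} {T : Pairing k R P' Q'} {X : Type*} [Infinite X]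

theorem nonempty_finsupp_equiv_finsupp_finsupp (S : Pairing k R P Q) :
    Nonempty (Equiv (S.finsupp X) ((S.finsupp X).finsupp X)) := by
  obtain ⟨f⟩ := nonempty_prod_self_equiv X
  exact ⟨(Equiv.finsuppDomCongr S f.symm).trans (.finsuppCurry S X X)⟩

theorem nonempty_finsupp_equiv_finsupp_prod_self (S : Pairing k R P Q) :
    Nonempty (Equiv (S.finsupp X) ((S.finsupp X).prod (S.finsupp X))) := by
  obtain ⟨f⟩ := nonempty_sum_self_equiv X
  exact ⟨(Equiv.finsuppDomCongr S f.symm).trans (.finsuppSum S X X)⟩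

theorem Retract.nonempty_finsupp_equiv_prod (e : Retract S (T.finsupp X)) :
    Nonempty (Equiv (T.finsupp X) ((S.finsupp X).prod (T.finsupp X))) := by
  obtain ⟨square⟩ := nonempty_finsupp_equiv_finsupp_finsupp (X := X) T
  obtain ⟨double⟩ := nonempty_finsupp_equiv_finsupp_prod_self (X := X) S
  have split : Equiv (T.finsupp X) ((S.finsupp X).prod (e.compl.finsupp X)) :=
    (square.trans (e.prodCompl.symm.finsuppCongr X)).trans (.finsuppProd S e.compl X)
  -- with `C := e.compl`: `T^(X) ≅ S^(X) × C^(X) ≅ (S^(X) × S^(X)) × C^(X) ≅ S^(X) × T^(X)`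
  exact ⟨((split.trans (double.prodCongr (.refl _))).trans (.prodAssoc _ _ _)).trans
    (.prodCongr (.refl _) split.symm)⟩

/-- Pełczyński's decomposition argument. -/
theorem nonempty_finsupp_equiv_finsupp (e : Retract S (T.finsupp X))
    (f : Retract T (S.finsupp X)) : Nonempty (Equiv (S.finsupp X) (T.finsupp X)) := by
  obtain ⟨absorbS⟩ := e.nonempty_finsupp_equiv_prod
  obtain ⟨absorbT⟩ := f.nonempty_finsupp_equiv_prod
  exact ⟨(absorbT.trans (.prodComm _ _)).trans absorbS.symm⟩

end Decomposition

end Pairing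

section Resolved

variable {k ι P : Type*} [CommRing k] [AddCommGroup P] [Module k P]

open Filter in
/-- The vectors `x` that are the sum of their components `D i x`, almost all of which vanish. -/
def resolved (D : ι → Module.End k P) : Submodule k P where
  carrier := {x | ∀ᶠ s : Finset ι in atTop, ∑ i ∈ s, D i x = x}
  add_mem' hx hy := by
    filter_upwards [hx, hy] with s hxs hys
    simp only [map_add, Finset.sum_add_distrib, hxs, hys]
  zero_mem' := by simp
  smul_mem' c x hx := by
    filter_upwards [hx] with s hs
    simp only [map_smul, ← Finset.smul_sum, hs]

theorem exists_finset_of_mem_resolved {D : ι → Module.End k P} {x : P} (hx : x ∈ resolved D) :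
    ∃ s : Finset ι, (∀ i ∉ s, D i x = 0) ∧ ∑ i ∈ s, D i x = x := by
  classical
  obtain ⟨s, hs⟩ := Filter.eventually_atTop.1 hx
  refine ⟨s, fun i hi => ?_, hs s le_rfl⟩
  have h := hs (insert i s) (Finset.subset_insert i s)
  rwa [Finset.sum_insert hi, hs s le_rfl, add_eq_right] at h

theorem resolved_eq_top_of_action {A : Type*} [AddCommGroup A] [Module k A]
    (ρ : A →ₗ[k] P →ₗ[k] P) (hρ : AddSubgroup.closure {x | ∃ a p, ρ a p = x} = ⊤)
    {D : ι → Module.End k A} (hD : resolved D = ⊤) {D' : ι → Module.End k P}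
    (h : ∀ i a p, D' i (ρ a p) = ρ (D i a) p) : resolved D' = ⊤ := by
  refine Submodule.toAddSubgroup_injective (top_unique (hρ.symm.le.trans ?_))
  rw [AddSubgroup.closure_le]
  rintro _ ⟨a, p, rfl⟩
  have ha : a ∈ resolved D := hD ▸ Submodule.mem_top
  filter_upwards [ha] with s hs
  simp only [h, ← LinearMap.sum_apply, ← map_sum, hs]

end Resolved

namespace Pairing

variable {k R P Q P' Q' : Type*} [CommRing k] [AddCommGroup R] [Module k R]
  [AddCommGroup P] [Module k P] [AddCommGroup Q] [Module k Q]
  [AddCommGroup P'] [Module k P'] [AddCommGroup Q'] [Module k Q']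
  {S : Pairing k R P Q} {T : Pairing k R P' Q'}

theorem nonempty_retract_finsupp {ι X : Type*} [Infinite X] (j : ι ↪ X)
    {D : ι → Module.End k P} (hD : resolved D = ⊤) {D' : ι → Module.End k Q}
    (hD' : resolved D' = ⊤) {κ : ι → Type*} [∀ i, Fintype (κ i)]
    (a : ∀ i, κ i → Hom S T) (b : ∀ i, κ i → Hom T S)
    (hab : ∀ i x, ∑ l, (b i l).map ((a i l).map x) = D i x)
    (hab' : ∀ i y, ∑ l, (a i l).adjoint ((b i l).adjoint y) = D' i y)
    (ha : ∀ i l x, D i x = 0 → (a i l).map x = 0)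
    (hb : ∀ i l y, D' i y = 0 → (b i l).adjoint y = 0) :
    Nonempty (Retract S (T.finsupp X)) := by
  have hx (x : P) : x ∈ resolved D := hD ▸ Submodule.mem_top
  have hy (y : Q) : y ∈ resolved D' := hD' ▸ Submodule.mem_top
  obtain ⟨f⟩ := nonempty_sigma_embedding j κ
  refine ⟨(Retract.ofFamily (fun i : Σ i, κ i => a i.1 i.2) (fun i => b i.1 i.2) (fun x => ?_)
    fun y => ?_).trans (Retract.finsuppOfEmbedding T f)⟩
  · obtain ⟨s, hs, hsum⟩ := exists_finset_of_mem_resolved (hx x)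
    refine ⟨s.sigma fun _ => Finset.univ, fun i hi => ha _ _ _ (hs i.1 (by simpa using hi)), ?_⟩
    simpa only [Finset.sum_sigma, hab] using hsum
  · obtain ⟨s, hs, hsum⟩ := exists_finset_of_mem_resolved (hy y)
    refine ⟨s.sigma fun _ => Finset.univ, fun i hi => hb _ _ _ (hs i.1 (by simpa using hi)), ?_⟩
    simpa only [Finset.sum_sigma, hab'] using hsum

section FiniteRank

variable {A B : Type*} [NonUnitalRing A] [Module k A] [NonUnitalRing B] [Module k B]

/-- The operator `x ↦ ⟨x, q⟩ p`. -/
def rankOne (S : Pairing k R P Q) : Q →ₗ[k] P →ₗ[k] Module.End k P :=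
  LinearMap.mk₂ k (fun q p => S.act.flip p ∘ₗ S.pair.flip q)
    (fun _ _ _ => by ext; simp) (fun _ _ _ => by ext; simp) (fun _ _ _ => by ext; simp)
    (fun _ _ _ => by ext; simp)

@[simp] theorem rankOne_apply (S : Pairing k R P Q) (q : Q) (p x : P) :
    S.rankOne q p x = S.act (S.pair x q) p := rfl

/-- The operators of finite rank: the sums of operators `x ↦ ⟨x, q⟩ p`. -/
def finiteRank (S : Pairing k R P Q) : Submodule k (Module.End k P) :=
  Submodule.map₂ S.rankOne ⊤ ⊤

theorem rankOne_mem_finiteRank (S : Pairing k R P Q) (q : Q) (p : P) :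
    S.rankOne q p ∈ S.finiteRank :=
  Submodule.apply_mem_map₂ _ trivial trivial

theorem Equiv.conj_rankOne (e : Equiv S T) (q : Q) (p : P) :
    e.map.conj (S.rankOne q p) = T.rankOne (e.dual q) (e.map p) := by
  ext x
  obtain ⟨x, rfl⟩ := e.map.surjective x
  simp

theorem Equiv.map_finiteRank (e : Equiv S T) :
    S.finiteRank.map (e.map.conj : Module.End k P →ₗ[k] Module.End k P') = T.finiteRank := by
  have h : S.rankOne.compr₂ (e.map.conj : Module.End k P →ₗ[k] Module.End k P') =
      T.rankOne.compl₁₂ (e.dual : Q →ₗ[k] Q') (e.map : P →ₗ[k] P') :=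
    LinearMap.ext₂ e.conj_rankOne
  rw [finiteRank, Submodule.map_map₂, h, ← Submodule.map₂_map_map, Submodule.map_top,
    Submodule.map_top, LinearEquiv.range, LinearEquiv.range, finiteRank]

/-- `ρ` identifies the opposite of the algebra `A` with the finite rank operators of `S`, that is,
`A` acts on `P` from the right. -/
structure IsFiniteRankRep (S : Pairing k R P Q) (ρ : A →ₗ[k] Module.End k P) : Prop where
  injective : Function.Injective ρ
  map_mul : ∀ a b, ρ (a * b) = ρ b * ρ a
  range_eq : LinearMap.range ρ = S.finiteRank

theorem range_eq_finiteRank {ρ : A →ₗ[k] Module.End k P} {δ : Q →ₗ[k] P →ₗ[k] A}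
    (h : δ.compr₂ ρ = S.rankOne) (hδ : Submodule.map₂ δ ⊤ ⊤ = ⊤) :
    LinearMap.range ρ = S.finiteRank := by
  rw [finiteRank, ← h, ← Submodule.map_map₂, hδ, Submodule.map_top]

theorem Equiv.exists_ringEquiv (e : Equiv S T) {ρ : A →ₗ[k] Module.End k P}
    {σ : B →ₗ[k] Module.End k P'} (hρ : S.IsFiniteRankRep ρ) (hσ : T.IsFiniteRankRep σ) :
    ∃ φ : A ≃+* B, ∀ (c : k) (a : A), φ (c • a) = c • φ a := by
  let φ : A ≃ₗ[k] B := (LinearEquiv.ofInjective ρ hρ.injective).trans <|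
    (e.map.conj.submoduleMap _).trans <|
    (LinearEquiv.ofEq _ _ (by rw [hρ.range_eq, hσ.range_eq, ← e.map_finiteRank])).trans
    (LinearEquiv.ofInjective σ hσ.injective).symm
  have σ_φ (a : A) : σ (φ a) = e.map.conj (ρ a) := by
    rw [← LinearEquiv.ofInjective_apply σ (h := hσ.injective)]
    simp [φ]
  refine ⟨{ φ with map_mul' := fun a b => hσ.injective ?_ }, φ.map_smul⟩
  calc σ (φ (a * b)) = e.map.conj (ρ b * ρ a) := by rw [σ_φ, hρ.map_mul]
    _ = e.map.conj (ρ b) * e.map.conj (ρ a) := e.map.conj_comp _ _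
    _ = σ (φ a * φ b) := by rw [hσ.map_mul, σ_φ, σ_φ]

end FiniteRank

end Pairing

namespace FMat

variable {k X B P Q R : Type*} [CommRing k] [NonUnitalRing B] [Module k B]
  [AddCommGroup P] [Module k P] [AddCommGroup Q] [Module k Q] [AddCommGroup R] [Module k R]

/-- The matrix with `(i, j)`-entry `b` and zeros elsewhere. -/
noncomputable def single (i j : X) (b : B) : FMat X B := (Finsupp.single (i, j) b : X × X →₀ B)

open scoped Classical in
theorem entry_single (i j i' j' : X) (b : B) :
    (single i j b).entry i' j' = if i = i' ∧ j = j' then b else 0 := by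
  refine (Finsupp.single_apply (a := (i, j)) (a' := (i', j')) (b := b)).trans ?_
  simp only [Prod.mk.injEq]

theorem induction_single {motive : FMat X B → Prop} (A : FMat X B) (zero : motive 0)
    (add : ∀ A A', motive A → motive A' → motive (A + A'))
    (single : ∀ i j b, motive (single i j b)) : motive A :=
  Finsupp.induction_linear (motive := motive) (show X × X →₀ B from A) zero
    (fun _ _ => add _ _) fun p b => single p.1 p.2 b

theorem single_mul_single_same (i j l : X) (a b : B) :
    single i j a * single j l b = single i l (a * b) := by
  refine ext fun i' l' => ?_
  rw [entry_mul, finsum_eq_single _ j]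
  · by_cases hi : i = i' <;> by_cases hl : l = l' <;> simp [entry_single, hi, hl]
  · intro j' hj
    simp [entry_single, Ne.symm hj]

theorem single_mul_single_of_ne {j j' : X} (h : j ≠ j') (i l : X) (a b : B) :
    single i j a * single j' l b = 0 := by
  refine ext fun i' l' => ?_
  rw [entry_mul, entry_zero]
  refine finsum_eq_zero_of_forall_eq_zero fun m => ?_
  by_cases hj : j = m
  · subst hj; simp [entry_single, Ne.symm h]
  · simp [entry_single, hj]

/-- The operator on row vectors given by the matrix of operators whose only non-zero entry is `f`,
at `(i, j)`. -/
noncomputable def endSingle (i j : X) : Module.End k P →ₗ[k] Module.End k (X →₀ P) :=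
  LinearMap.lcomp k (X →₀ P) (Finsupp.lapply i) ∘ₗ LinearMap.compRight k (Finsupp.lsingle j)

@[simp] theorem endSingle_apply (i j : X) (f : Module.End k P) (x : X →₀ P) :
    endSingle i j f x = Finsupp.single j (f (x i)) := rfl

theorem endSingle_rankOne (S : Pairing k R P Q) (i j : X) (q : Q) (p : P) :
    endSingle i j (S.rankOne q p) =
      (S.finsupp X).rankOne (Finsupp.single i q) (Finsupp.single j p) :=
  LinearMap.ext fun x => by simp [Pairing.finsupp_pair_single_right]

/-- The right action of matrices over `B` on row vectors over a right `B`-module. -/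
noncomputable def rowAct (ρ : B →ₗ[k] Module.End k P) : FMat X B →ₗ[k] Module.End k (X →₀ P) :=
  (Finsupp.lsum k fun p : X × X => endSingle p.1 p.2 ∘ₗ ρ :
    (X × X →₀ B) →ₗ[k] Module.End k (X →₀ P))

variable {ρ : B →ₗ[k] Module.End k P}

@[simp] theorem rowAct_single (ρ : B →ₗ[k] Module.End k P) (i j : X) (b : B) :
    rowAct ρ (single i j b) = endSingle i j (ρ b) :=
  Finsupp.lsum_single k _ (i, j) b

theorem rowAct_mul (hρ : ∀ a b, ρ (a * b) = ρ b * ρ a) (A A' : FMat X B) :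
    rowAct ρ (A * A') = rowAct ρ A' * rowAct ρ A := by
  induction A using induction_single with
  | zero => simp
  | add A₁ A₂ h₁ h₂ => rw [add_mul, map_add, h₁, h₂, map_add, mul_add]
  | single i j a =>
    induction A' using induction_single with
    | zero => simp
    | add A₁ A₂ h₁ h₂ => rw [mul_add, map_add, h₁, h₂, map_add, add_mul]
    | single j' l b =>
      refine LinearMap.ext fun x => ?_
      by_cases h : j = j'
      · subst h
        simp [single_mul_single_same, hρ]
      · simp [single_mul_single_of_ne h, h]

theorem rowAct_apply_single (ρ : B →ₗ[k] Module.End k P) (A : FMat X B) (i j : X) (p : P) :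
    rowAct ρ A (Finsupp.single i p) j = ρ (A.entry i j) p := by
  classical
  induction A using induction_single with
  | zero => simp
  | add A₁ A₂ h₁ h₂ => simp [h₁, h₂]
  | single i' j' a =>
    by_cases hi : i = i' <;> by_cases hj : j' = j <;>
      simp [entry_single, hi, hj, eq_comm]

theorem rowAct_injective (hρ : Function.Injective ρ) :
    Function.Injective (rowAct (X := X) ρ) := fun A A' h =>
  ext fun i j => hρ <| LinearMap.ext fun p => by simp only [← rowAct_apply_single, h]

theorem rowAct_mem_finiteRank {S : Pairing k R P Q} (hρ : ∀ b, ρ b ∈ S.finiteRank)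
    (A : FMat X B) : rowAct ρ A ∈ (S.finsupp X).finiteRank := by
  have endSingle_mem (i j : X) :
      S.finiteRank ≤ (S.finsupp X).finiteRank.comap (endSingle i j) :=
    Submodule.map₂_le.2 fun q _ p _ => by
      rw [Submodule.mem_comap, endSingle_rankOne]
      exact Pairing.rankOne_mem_finiteRank _ _ _
  induction A using induction_single with
  | zero => simp
  | add A₁ A₂ h₁ h₂ => rw [map_add]; exact add_mem h₁ h₂
  | single i j b => rw [rowAct_single]; exact endSingle_mem i j (hρ b)

theorem finiteRank_le_range_rowAct {S : Pairing k R P Q}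
    (hρ : S.finiteRank ≤ LinearMap.range ρ) :
    (S.finsupp X).finiteRank ≤ LinearMap.range (rowAct (X := X) ρ) := by
  suffices ∀ y x, (S.finsupp X).rankOne y x ∈ LinearMap.range (rowAct (X := X) ρ) from
    Submodule.map₂_le.2 fun y _ x _ => this y x
  intro y x
  induction y using Finsupp.induction_linear with
  | zero => simp
  | add y₁ y₂ h₁ h₂ => rw [map_add, LinearMap.add_apply]; exact add_mem h₁ h₂
  | single i q =>
    induction x using Finsupp.induction_linear with
    | zero => simp
    | add x₁ x₂ h₁ h₂ => rw [map_add]; exact add_mem h₁ h₂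
    | single j p =>
      obtain ⟨b, hb⟩ := hρ (S.rankOne_mem_finiteRank q p)
      exact ⟨single i j b, by rw [rowAct_single, hb, endSingle_rankOne]⟩

end FMat

theorem Pairing.IsFiniteRankRep.rowAct {k X B P Q R : Type*} [CommRing k] [NonUnitalRing B]
    [Module k B] [AddCommGroup P] [Module k P] [AddCommGroup Q] [Module k Q] [AddCommGroup R]
    [Module k R] {S : Pairing k R P Q} {ρ : B →ₗ[k] Module.End k P} (hρ : S.IsFiniteRankRep ρ) :
    (S.finsupp X).IsFiniteRankRep (FMat.rowAct (X := X) ρ) where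
  injective := FMat.rowAct_injective hρ.injective
  map_mul := FMat.rowAct_mul hρ.map_mul
  range_eq := le_antisymm
    (LinearMap.range_le_iff_comap.2 <| eq_top_iff.2 fun A _ =>
      FMat.rowAct_mem_finiteRank (fun b => hρ.range_eq ▸ LinearMap.mem_range_self ρ b) A)
    (FMat.finiteRank_le_range_rowAct hρ.range_eq.ge)

section LocalUnits

variable {k R : Type*} [CommRing k] [NonUnitalRing R] [Module k R] [IsScalarTower k R R]
  [SMulCommClass k R R] {E : Set R}

namespace IsOrthogonalLocalUnits

theorem resolved_mulRight (hE : IsOrthogonalLocalUnits k E) :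
    resolved (fun e : E => LinearMap.mulRight k (e : R)) = ⊤ := by
  classical
  rw [eq_top_iff, ← hE.right_internal.submodule_iSup_eq_top, iSup_le_iff]
  rintro e _ ⟨r, rfl⟩
  filter_upwards [Filter.eventually_ge_atTop {e}] with s hs
  rw [Finset.sum_eq_single_of_mem e (hs (Finset.mem_singleton_self e)) fun f _ hf => ?_]
  · simp [mul_assoc, hE.idem e e.2]
  · simp [mul_assoc, hE.orthogonal e e.2 f f.2 (Subtype.coe_ne_coe.2 hf.symm)]

theorem resolved_mulLeft (hE : IsOrthogonalLocalUnits k E) :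
    resolved (fun e : E => LinearMap.mulLeft k (e : R)) = ⊤ := by
  classical
  rw [eq_top_iff, ← hE.left_internal.submodule_iSup_eq_top, iSup_le_iff]
  rintro e _ ⟨r, rfl⟩
  filter_upwards [Filter.eventually_ge_atTop {e}] with s hs
  rw [Finset.sum_eq_single_of_mem e (hs (Finset.mem_singleton_self e)) fun f _ hf => ?_]
  · simp [← mul_assoc, hE.idem e e.2]
  · simp [← mul_assoc, hE.orthogonal f f.2 e e.2 (Subtype.coe_ne_coe.2 hf)]

theorem exists_sum_mul_eq (hE : IsOrthogonalLocalUnits k E) (r : R) :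
    ∃ s : Finset E, ∑ e ∈ s, (e : R) * r = r := by
  obtain ⟨s, -, hs⟩ := exists_finset_of_mem_resolved
    (hE.resolved_mulLeft ▸ Submodule.mem_top : r ∈ resolved _)
  exact ⟨s, hs⟩

theorem eq_zero_of_forall_mul (hE : IsOrthogonalLocalUnits k E) {r : R} (h : ∀ x, x * r = 0) :
    r = 0 := by
  obtain ⟨s, hs⟩ := hE.exists_sum_mul_eq r
  exact hs.symm.trans (Finset.sum_eq_zero fun e _ => h e)

theorem map₂_mul_top_top (hE : IsOrthogonalLocalUnits k E) :
    Submodule.map₂ (LinearMap.mul k R) ⊤ ⊤ = ⊤ := by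
  refine eq_top_iff.2 fun r _ => ?_
  obtain ⟨s, hs⟩ := hE.exists_sum_mul_eq r
  rw [← hs]
  exact Submodule.sum_mem _ fun e _ => Submodule.apply_mem_map₂ (LinearMap.mul k R) trivial trivial

end IsOrthogonalLocalUnits

/-- The pairing of an algebra with itself by multiplication. -/
def Pairing.regular (k R : Type*) [CommRing k] [NonUnitalRing R] [Module k R]
    [IsScalarTower k R R] [SMulCommClass k R R] : Pairing k R R R :=
  ⟨LinearMap.mul k R, LinearMap.mul k R⟩

theorem IsOrthogonalLocalUnits.isFiniteRankRep_regular (hE : IsOrthogonalLocalUnits k E) :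
    (Pairing.regular k R).IsFiniteRankRep (LinearMap.mul k R).flip where
  injective := (injective_iff_map_eq_zero _).2 fun _ h =>
    hE.eq_zero_of_forall_mul (LinearMap.congr_fun h)
  map_mul a b := LinearMap.ext fun x => (mul_assoc x a b).symm
  range_eq := Pairing.range_eq_finiteRank (δ := LinearMap.mul k R)
    (LinearMap.ext₂ fun q p => LinearMap.ext fun x => (mul_assoc x q p).symm) hE.map₂_mul_top_top

end LocalUnits

namespace MoritaContext

section Pair

variable {k R R' M M' : Type*} [CommRing k]
  [NonUnitalRing R] [Module k R] [NonUnitalRing R'] [Module k R']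
  [AddCommGroup M] [Module k M] [AddCommGroup M'] [Module k M']

/-- The bilinear map `(m, m') ↦ τ(m ⊗ m')`. -/
def pair (C : MoritaContext k R R' M M') : M →ₗ[k] M' →ₗ[k] R :=
  (TensorProduct.mk k M M').compr₂ (C.τ ∘ₗ (balancing C.bimod C.bimod').mkQ)

/-- The context with the roles of the two algebras exchanged. -/
def swap (C : MoritaContext k R R' M M') : MoritaContext k R' R M' M where
  bimod := C.bimod'
  bimod' := C.bimod
  τ := C.τ'
  τ' := C.τ
  τ_left := C.τ'_left
  τ_right := C.τ'_right
  τ'_left := C.τ_left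
  τ'_right := C.τ_right
  assoc := C.assoc'
  assoc' := C.assoc

variable (C : MoritaContext k R R' M M')

theorem pair_left (r : R) (m : M) (m' : M') :
    C.pair (C.bimod.left r m) m' = r * C.pair m m' := C.τ_left r m m'

theorem pair_right (r : R) (m : M) (m' : M') :
    C.pair m (C.bimod'.right r m') = C.pair m m' * r := C.τ_right r m m'

theorem pair_balanced (b : R') (m : M) (m' : M') :
    C.pair (C.bimod.right b m) m' = C.pair m (C.bimod'.left b m') :=
  congrArg C.τ ((Submodule.Quotient.eq _).2 (Submodule.subset_span ⟨m, b, m', rfl⟩))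

theorem left_pair (m₁ : M) (m' : M') (m₂ : M) :
    C.bimod.left (C.pair m₁ m') m₂ = C.bimod.right (C.swap.pair m' m₂) m₁ := C.assoc m₁ m' m₂

theorem left_swap_pair (m₁ : M') (m : M) (m₂ : M') :
    C.bimod'.left (C.swap.pair m₁ m) m₂ = C.bimod'.right (C.pair m m₂) m₁ := C.assoc' m₁ m m₂

variable {C}

theorem exists_sum_pair (hτ : Function.Surjective C.τ) (r : R) :
    ∃ (n : ℕ) (v : Fin n → M) (u : Fin n → M'), ∑ i, C.pair (v i) (u i) = r := by
  obtain ⟨t, rfl⟩ := (hτ.comp (Submodule.mkQ_surjective _)) r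
  obtain ⟨n, v, u, rfl⟩ := t.exists_sum_tmul_eq
  exact ⟨n, v, u, (map_sum (C.τ ∘ₗ Submodule.mkQ _) _ _).symm⟩

theorem map₂_pair_top_top (hτ : Function.Surjective C.τ) : Submodule.map₂ C.pair ⊤ ⊤ = ⊤ := by
  refine eq_top_iff.2 fun r _ => ?_
  obtain ⟨n, v, u, rfl⟩ := exists_sum_pair hτ r
  exact Submodule.sum_mem _ fun i _ => Submodule.apply_mem_map₂ C.pair trivial trivial

theorem exists_sum_pair_of_idempotent (hτ : Function.Surjective C.τ) {e : R} (he : e * e = e) :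
    ∃ (n : ℕ) (v : Fin n → M) (u : Fin n → M'), ∑ i, C.pair (v i) (u i) = e ∧
      (∀ i, C.bimod.left e (v i) = v i) ∧ ∀ i, C.bimod'.right e (u i) = u i := by
  obtain ⟨n, v, u, h⟩ := exists_sum_pair hτ e
  refine ⟨n, fun i => C.bimod.left e (v i), fun i => C.bimod'.right e (u i), ?_, ?_, ?_⟩
  · simp_rw [pair_left, pair_right, ← Finset.mul_sum, ← Finset.sum_mul, h, he]
  · exact fun i => by rw [← C.bimod.left_mul, he]
  · exact fun i => by rw [← C.bimod'.right_mul, he]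

variable (C)

/-- The pairing of the two bimodules of a context, with values in `R`. -/
def pairing : Pairing k R M M' := ⟨C.bimod.left, C.pair⟩

variable [IsScalarTower k R R] [SMulCommClass k R R]

/-- The morphism `r ↦ r v`. -/
def leftHom (v : M) : Pairing.Hom (Pairing.regular k R) C.pairing where
  map := C.bimod.left.flip v
  adjoint := C.pair v
  map_act r := LinearMap.ext fun s => C.bimod.left_mul r s v
  pair_map := LinearMap.ext₂ fun r m' => C.pair_left r v m'

/-- The morphism `m ↦ τ(m ⊗ u)`. -/
def pairHom (u : M') : Pairing.Hom C.pairing (Pairing.regular k R) where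
  map := C.pair.flip u
  adjoint := C.bimod'.right.flip u
  map_act r := LinearMap.ext fun m => C.pair_left r m u
  pair_map := LinearMap.ext₂ fun m r => (C.pair_right r m u).symm

variable {C} {X : Type*} [Infinite X]

theorem nonempty_retract_regular_pairing {E : Set R} (hE : IsOrthogonalLocalUnits k E) (j : E ↪ X)
    (hτ : Function.Surjective C.τ) :
    Nonempty (Pairing.Retract (Pairing.regular k R) (C.pairing.finsupp X)) := by
  choose n v u sum_pair hv hu using fun e : E => exists_sum_pair_of_idempotent hτ (hE.idem e e.2)
  refine Pairing.nonempty_retract_finsupp j hE.resolved_mulRight hE.resolved_mulLeft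
    (fun e i => C.leftHom (v e i)) (fun e i => C.pairHom (u e i))
    (fun e r => ?_) (fun e r => ?_) (fun e i r (h : r * e = 0) => ?_)
    fun e i r (h : e * r = 0) => ?_
  · change ∑ i, C.pair (C.bimod.left r (v e i)) (u e i) = r * e
    simp_rw [pair_left, ← Finset.mul_sum, sum_pair]
  · change ∑ i, C.pair (v e i) (C.bimod'.right r (u e i)) = e * r
    simp_rw [pair_right, ← Finset.sum_mul, sum_pair]
  · calc C.bimod.left r (v e i) = C.bimod.left (r * e) (v e i) := by
          rw [C.bimod.left_mul, hv]
      _ = 0 := by rw [h, map_zero, LinearMap.zero_apply]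
  · calc C.bimod'.right r (u e i) = C.bimod'.right (e * r) (u e i) := by
          rw [C.bimod'.right_mul, hu]
      _ = 0 := by rw [h, map_zero, LinearMap.zero_apply]

end Pair

variable {k R R' M M' : Type*} [CommRing k] [NonUnitalRing R] [Module k R]
  [NonUnitalRing R'] [Module k R'] [IsScalarTower k R' R'] [SMulCommClass k R' R']
  [AddCommGroup M] [Module k M] [AddCommGroup M'] [Module k M']
  {C : MoritaContext k R R' M M'} {F : Set R'}

theorem nonempty_retract_pairing_regular [IsScalarTower k R R] [SMulCommClass k R R]
    {X : Type*} [Infinite X] (hF : IsOrthogonalLocalUnits k F) (j : F ↪ X)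
    (hM : AddSubgroup.closure {x : M | ∃ b m, C.bimod.right b m = x} = ⊤)
    (hM' : AddSubgroup.closure {x : M' | ∃ b m', C.bimod'.left b m' = x} = ⊤)
    (hτ' : Function.Surjective C.τ') :
    Nonempty (Pairing.Retract C.pairing ((Pairing.regular k R).finsupp X)) := by
  have resolved_right : resolved (fun f : F => C.bimod.right f) = ⊤ :=
    resolved_eq_top_of_action C.bimod.right hM hF.resolved_mulRight
      fun f b m => (C.bimod.right_mul b f m).symm
  have resolved_left : resolved (fun f : F => C.bimod'.left f) = ⊤ :=
    resolved_eq_top_of_action C.bimod'.left hM' hF.resolved_mulLeft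
      fun f b m' => (C.bimod'.left_mul f b m').symm
  choose n u v sum_pair hu hv using fun f : F =>
    exists_sum_pair_of_idempotent (C := C.swap) hτ' (hF.idem f f.2)
  refine Pairing.nonempty_retract_finsupp j resolved_right resolved_left
    (fun f i => C.pairHom (u f i)) (fun f i => C.leftHom (v f i))
    (fun f m => ?_) (fun f m' => ?_) (fun f i m hm => ?_) fun f i m' hm' => ?_
  · change ∑ i, C.bimod.left (C.pair m (u f i)) (v f i) = C.bimod.right f m
    simp_rw [left_pair, ← LinearMap.sum_apply, ← map_sum, sum_pair]
  · change ∑ i, C.bimod'.right (C.pair (v f i) m') (u f i) = C.bimod'.left f m'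
    simp_rw [← left_swap_pair, ← LinearMap.sum_apply, ← map_sum, sum_pair]
  · calc C.pair m (u f i) = C.pair m (C.bimod'.left f (u f i)) := congrArg _ (hu f i).symm
      _ = C.pair (C.bimod.right f m) (u f i) := (C.pair_balanced f m _).symm
      _ = 0 := by rw [hm, map_zero, LinearMap.zero_apply]
  · calc C.pair (v f i) m' = C.pair (C.bimod.right f (v f i)) m' :=
          congrArg (C.pair · m') (hv f i).symm
      _ = C.pair (v f i) (C.bimod'.left f m') := C.pair_balanced f _ m'
      _ = 0 := by rw [hm', map_zero]

theorem eq_zero_of_forall_right (hF : IsOrthogonalLocalUnits k F)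
    (hτ' : Function.Surjective C.τ') {s : R'} (h : ∀ m, C.bimod.right s m = 0) : s = 0 := by
  refine hF.eq_zero_of_forall_mul fun x => ?_
  obtain ⟨n, u, v, rfl⟩ := exists_sum_pair (C := C.swap) hτ' x
  rw [Finset.sum_mul]
  refine Finset.sum_eq_zero fun i _ => ?_
  calc C.swap.pair (u i) (v i) * s = C.swap.pair (u i) (C.bimod.right s (v i)) :=
        (C.swap.pair_right s (u i) (v i)).symm
    _ = 0 := by rw [h, map_zero]

theorem isFiniteRankRep_pairing (hF : IsOrthogonalLocalUnits k F)
    (hτ' : Function.Surjective C.τ') : C.pairing.IsFiniteRankRep C.bimod.right where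
  injective := (injective_iff_map_eq_zero _).2 fun _ h =>
    eq_zero_of_forall_right hF hτ' (LinearMap.congr_fun h)
  map_mul a b := LinearMap.ext (C.bimod.right_mul a b)
  range_eq := Pairing.range_eq_finiteRank (δ := C.swap.pair)
    (LinearMap.ext₂ fun q p => LinearMap.ext fun x => (C.left_pair x q p).symm)
    (map₂_pair_top_top (C := C.swap) hτ')

end MoritaContext

end StableMorita

theorem corollary7p1 {k R R' M M' X : Type*} [CommRing k]
    [NonUnitalRing R] [Module k R] [IsScalarTower k R R] [SMulCommClass k R R]
    [NonUnitalRing R'] [Module k R'] [IsScalarTower k R' R'] [SMulCommClass k R' R']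
    [AddCommGroup M] [Module k M] [AddCommGroup M'] [Module k M']
    (E : Set R) (F : Set R')
    (hE : StableMorita.IsOrthogonalLocalUnits k E) (hF : StableMorita.IsOrthogonalLocalUnits k F)
    [Infinite X]
    (hEX : Nonempty (E ↪ X)) (hFX : Nonempty (F ↪ X))
    (C : StableMorita.MoritaContext k R R' M M')
    (hM : C.bimod.IsUnital) (hM' : C.bimod'.IsUnital)
    (hτ : Function.Surjective C.τ) (hτ' : Function.Surjective C.τ') :
    ∃ φ : StableMorita.FMat X R ≃+* StableMorita.FMat X R',
      ∀ (c : k) (A : StableMorita.FMat X R), φ (c • A) = c • φ A := by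
  open StableMorita in
  obtain ⟨i⟩ := hEX
  obtain ⟨j⟩ := hFX
  obtain ⟨f⟩ := MoritaContext.nonempty_retract_regular_pairing hE i hτ
  obtain ⟨g⟩ := MoritaContext.nonempty_retract_pairing_regular hF j hM.right_unital
    hM'.left_unital hτ'
  obtain ⟨e⟩ : Nonempty (((Pairing.regular k R).finsupp X).Equiv (C.pairing.finsupp X)) :=
    Pairing.nonempty_finsupp_equiv_finsupp f g
  exact e.exists_ringEquiv hE.isFiniteRankRep_regular.rowAct
    (MoritaContext.isFiniteRankRep_pairing hF hτ').rowAct
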